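/- Let $d\ge 1$ be an integer, $\lambda>0$, $\alpha>0$, $\tau\in\mathbb R$. Call a function $L:(0,\infty)\to(0,\infty)$ slowly varying if it is measurable and $L(ct)/L(t)\to 1$ as $t\to\infty$ for every $c>0$. Let $P$ be a probability law on $(0,\infty)$ whose tail is $P((w,\infty))=w^{-(\tau-1)}L(w)$ for all $w>0$, with $L$ slowly varying. Let $\eta$ be a homogeneous Poisson point process on $\mathbb R^d$ of intensity $\lambda$, with law $\mathrm P$. Given $\eta$, let $P^\eta$ be the law of the following random simple graph with vertex set $\eta$: the vertices $x\in\eta$ carry i.i.d. weights $W_x>0$ with law $P$ and, conditionally on the weights, distinct vertices $x,y\in\eta$ are joined by an edge, independently for all unordered pairs, with probability $$1-\exp\left(-\frac{W_xW_y}{\|x-y\|^{\alpha}}\right),$$ where $\|\cdot\|$ is the Euclidean norm. Let $D_x\in\{0,1,2,\dots\}\cup\{\infty\}$ be the degree of $x\in\eta$, that is, its number of neighbours in the graph. **Theorem 2.2 (label degree).** Suppose that $\alpha>d$ and $\gamma:=\alpha(\tau-1)/d>1$. Then, for $\mathrm P$-almost every $\eta$, the following holds: for each $x\in\eta$ there exists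 a slowly varying function $\ell(\cdot)=\ell(\cdot,\eta,x)$ such that $$P^\eta(D_x>s)=s^{-\gamma}\,\ell(s)\qquad\text{for all } s>0.$$ -/

import Mathlib

open MeasureTheory ProbabilityTheory Filter Topology
open scoped NNReal ENNReal

noncomputable section

/-- `L`, viewed as a function on `(0, ∞)`, is slowly varying at infinity: it is positive and
measurable on `(0, ∞)`, and `L (c * t) / L t → 1` as `t → ∞` for every `c > 0`. -/
structure IsSlowlyVarying (L : ℝ → ℝ) : Prop where
  pos : ∀ t : ℝ, 0 < t → 0 < L t
  measurable : Measurable (fun t : Set.Ioi (0 : ℝ) => L t)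
  tendsto : ∀ c : ℝ, 0 < c → Tendsto (fun t => L (c * t) / L t) atTop (𝓝 1)

/-- The random set of points `η`, defined on the probability space `(Ω, Pr)`, is a homogeneous
Poisson point process in `ℝ^d` of intensity `lam`: the number of points in a Borel set of finite
volume is Poisson with mean `lam` times the volume, and the numbers of points in pairwise
disjoint Borel sets are independent. (Almost sure local finiteness is a consequence.) -/
structure IsPoissonPointProcess {d : ℕ} {Ω : Type*} [MeasurableSpace Ω]
    (lam : ℝ≥0) (η : Ω → Set (EuclideanSpace ℝ (Fin d))) (Pr : Measure Ω) : Prop where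
  measurable_count : ∀ A : Set (EuclideanSpace ℝ (Fin d)), MeasurableSet A →
    Measurable (fun ω => (η ω ∩ A).encard)
  law_count : ∀ A : Set (EuclideanSpace ℝ (Fin d)), MeasurableSet A → volume A ≠ ∞ →
    ∀ k : ℕ, Pr {ω | (η ω ∩ A).encard = (k : ℕ∞)} =
      poissonMeasure (lam * (volume A).toNNReal) {k}
  indep_count : ∀ (n : ℕ) (A : Fin n → Set (EuclideanSpace ℝ (Fin d))),
    (∀ i, MeasurableSet (A i)) → Pairwise (fun i j => Disjoint (A i) (A j)) →
    iIndepFun (fun (i : Fin n) (ω : Ω) => (η ω ∩ A i).encard) Pr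

namespace ScaleFreePercolation

/-- The probability that two vertices `x`, `y` with weights `a`, `b` are linked. -/
def linkProb {d : ℕ} (α : ℝ) (x y : EuclideanSpace ℝ (Fin d)) (a b : ℝ) : ℝ :=
  1 - Real.exp (-(a * b / ‖x - y‖ ^ α))

/-- The sample space of the graph on a fixed vertex set `V`: a weight for every vertex and,
for every unordered pair of vertices, a number in `[0, 1]` used to draw the edge. -/
abbrev Sample {d : ℕ} (V : Set (EuclideanSpace ℝ (Fin d))) : Type :=
  (V → ℝ) × (Sym2 V → unitInterval)

/-- The quenched law on the vertex set `V`: the weights are i.i.d. with law `μ`, the edge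
variables are i.i.d. uniform on `[0, 1]`, and weights and edge variables are independent. -/
def quenchedLaw {d : ℕ} (μ : Measure ℝ) [IsProbabilityMeasure μ]
    (V : Set (EuclideanSpace ℝ (Fin d))) : Measure (Sample V) :=
  (Measure.infinitePi (fun _ : V => μ)).prod
    (Measure.infinitePi (fun _ : Sym2 V => (volume : Measure unitInterval)))

/-- The random graph on the vertex set `V`. Under `quenchedLaw μ V`, conditionally on the weights
`g.1`, distinct vertices `x`, `y` are joined with probability `linkProb α x y (g.1 x) (g.1 y)`,
independently for all unordered pairs. -/
def graph {d : ℕ} (α : ℝ) {V : Set (EuclideanSpace ℝ (Fin d))} (g : Sample V) :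
    SimpleGraph V where
  Adj x y := x ≠ y ∧ (g.2 s(x, y) : ℝ) < linkProb α (x : EuclideanSpace ℝ (Fin d)) y (g.1 x) (g.1 y)
  symm := ⟨fun x y h => by
    refine ⟨h.1.symm, ?_⟩
    have h2 := h.2
    rw [Sym2.eq_swap, linkProb, norm_sub_rev, mul_comm] at h2
    exact h2⟩
  loopless := ⟨fun _ h => h.1 rfl⟩

/-- The degree of the vertex `x`, possibly infinite: the number of neighbours of `x`. -/
def degree {d : ℕ} (α : ℝ) {V : Set (EuclideanSpace ℝ (Fin d))} (x : V) (g : Sample V) : ℕ∞ :=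
  ((graph α g).neighborSet x).encard

end ScaleFreePercolation

end

/-!
The degree of a vertex `x` is large essentially only when its weight is large. Given a weight `w`, the
degree of `x` is a sum of independent indicators whose mean `m w` is asymptotic to `C * w ^ (d / α)`,
and it concentrates exponentially around `m w`. Hence `P(D_x > s)` is squeezed between the values of
the weight tail at weights close to `(s / C) ^ (α / d)`, up to errors `exp (-c * s)`
(`quenchedLaw_degree_le`, `le_quenchedLaw_degree`). These errors are negligible because a regularly
varying tail decays at most polynomially (`IsSlowlyVarying.exists_le_tail`), and so
`P(D_x > s) ∼ P(W > (s / C) ^ (α / d))` (`IsSlowlyVarying.tendsto_div_of_squeeze`), which is regularly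
varying of index `-α * (τ - 1) / d`.

The link probabilities increase with the weight of `x`, so `D_x` can be compared with the number of
links that `x` would have if its weight were a fixed number `w`. This replaces conditioning on the
weight, and concentration is needed only for that number (`linkNbrs`). The Chernoff bounds use just
that a sum of independent indicators has a moment generating function at most
`exp (m * (exp θ - 1))`.

The only property of the Poisson process that matters is that almost surely the number of points in
a ball of radius `r` is asymptotic to a positive multiple of `r ^ d`
(`IsPoissonPointProcess.ae_tendsto_ncard_ball`). The mean `m w` is the integral over `(a, u)` of the
number of points within distance `w ^ (1 / α) * linkRadius α (a, u)` of `x`, so dominated convergence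
gives its asymptotics (`exists_tendsto_tsum_link`). The limit is finite because `α > d` and because
the weights have a moment of order `d / α < τ - 1` (`IsSlowlyVarying.lintegral_rpow_ne_top`).
-/

/-! ### Chernoff bounds for sub-Poissonian variables -/

/-- Upper Chernoff bound for a variable whose moment generating function is at most that of a Poisson
variable of mean `m`, with the optimal parameter `θ = -log q`. -/
lemma measureReal_ge_le_of_mgf_le {Ω : Type*} [MeasurableSpace Ω] {P : Measure Ω}
    [IsProbabilityMeasure P] {X : Ω → ℝ} {m q s : ℝ}
    (hint : ∀ θ, Integrable (fun ω => Real.exp (θ * X ω)) P)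
    (hmgf : ∀ θ, mgf X P θ ≤ Real.exp (m * (Real.exp θ - 1)))
    (hq : 0 < q) (hq1 : q ≤ 1) (hm : m ≤ q * s) :
    P.real {ω | s ≤ X ω} ≤ Real.exp (-(q - 1 - Real.log q) * s) := by
  have hθ : 0 ≤ -Real.log q := neg_nonneg.2 (Real.log_nonpos hq.le hq1)
  refine (measure_ge_le_exp_mul_mgf s hθ (hint _)).trans ?_
  refine (mul_le_mul_of_nonneg_left (hmgf _) (Real.exp_pos _).le).trans ?_
  rw [← Real.exp_add, Real.exp_neg, Real.exp_log hq, Real.exp_le_exp]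
  have h1 : 0 ≤ q⁻¹ - 1 := sub_nonneg.2 ((one_le_inv₀ hq).2 hq1)
  have h2 := mul_le_mul_of_nonneg_right hm h1
  have h3 : q * s * (q⁻¹ - 1) = s - q * s := by field_simp
  linarith

/-- Lower Chernoff bound under the same Poissonian bound on the moment generating function. -/
lemma measureReal_le_le_of_mgf_le {Ω : Type*} [MeasurableSpace Ω] {P : Measure Ω}
    [IsProbabilityMeasure P] {X : Ω → ℝ} {m q s : ℝ}
    (hint : ∀ θ, Integrable (fun ω => Real.exp (θ * X ω)) P)
    (hmgf : ∀ θ, mgf X P θ ≤ Real.exp (m * (Real.exp θ - 1)))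
    (hq1 : 1 ≤ q) (hm : q * s ≤ m) :
    P.real {ω | X ω ≤ s} ≤ Real.exp (-(q - 1 - Real.log q) * s) := by
  have hq : 0 < q := by linarith
  have hθ : -Real.log q ≤ 0 := neg_nonpos.2 (Real.log_nonneg hq1)
  refine (measure_le_le_exp_mul_mgf s hθ (hint _)).trans ?_
  refine (mul_le_mul_of_nonneg_left (hmgf _) (Real.exp_pos _).le).trans ?_
  rw [← Real.exp_add, Real.exp_neg, Real.exp_log hq, Real.exp_le_exp]
  have h1 : 0 ≤ 1 - q⁻¹ := sub_nonneg.2 (inv_le_one_of_one_le₀ hq1)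
  have h2 := mul_le_mul_of_nonneg_right hm h1
  have h3 : q * s * (1 - q⁻¹) = q * s - s := by field_simp
  linarith

lemma sub_one_sub_log_pos {q : ℝ} (hq : 0 < q) (hq1 : q ≠ 1) : 0 < q - 1 - Real.log q := by
  linarith [Real.log_lt_sub_one_of_pos hq hq1]

/-! ### The law of large numbers for a Poisson process in growing balls -/

lemma integrable_exp_mul_poissonMeasure (r : ℝ≥0) (θ : ℝ) :
    Integrable (fun n : ℕ => Real.exp (θ * n)) (poissonMeasure r) := by
  rw [integrable_poissonMeasure_iff]
  have h := (Real.summable_pow_div_factorial (r * Real.exp θ)).mul_left (Real.exp (-r))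
  refine h.congr fun n => ?_
  rw [Real.norm_eq_abs, abs_of_pos (Real.exp_pos _), mul_pow, ← Real.exp_nat_mul, mul_comm θ]
  ring

lemma integral_exp_mul_poissonMeasure (r : ℝ≥0) (θ : ℝ) :
    ∫ n : ℕ, Real.exp (θ * n) ∂(poissonMeasure r) = Real.exp (r * (Real.exp θ - 1)) := by
  rw [integral_poissonMeasure]
  have h := (NormedSpace.expSeries_div_hasSum_exp ((r : ℝ) * Real.exp θ)).mul_left (Real.exp (-r))
  rw [← Real.exp_eq_exp_ℝ, ← Real.exp_add] at h
  have e : (r : ℝ) * (Real.exp θ - 1) = -r + r * Real.exp θ := by ring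
  rw [e, ← h.tsum_eq]
  congr with n
  rw [smul_eq_mul, mul_pow, ← Real.exp_nat_mul, mul_comm θ]
  ring

namespace IsPoissonPointProcess

variable {d : ℕ} {Ω : Type*} [MeasurableSpace Ω] {lam : ℝ≥0}
  {η : Ω → Set (EuclideanSpace ℝ (Fin d))} {Pr : Measure Ω} [IsProbabilityMeasure Pr]

lemma ae_finite (hη : IsPoissonPointProcess lam η Pr) {A : Set (EuclideanSpace ℝ (Fin d))}
    (hA : MeasurableSet A) (hv : volume A ≠ ∞) : ∀ᵐ ω ∂Pr, (η ω ∩ A).Finite := by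
  have hm : ∀ k : ℕ, MeasurableSet {ω | (η ω ∩ A).encard = (k : ℕ∞)} := fun k =>
    hη.measurable_count A hA (measurableSet_singleton _)
  have h1 : Pr (⋃ k : ℕ, {ω | (η ω ∩ A).encard = (k : ℕ∞)}) = 1 := by
    rw [measure_iUnion _ hm]
    · simp_rw [hη.law_count A hA hv]
      rw [← measure_iUnion _ (fun k => measurableSet_singleton k)]
      · rw [Set.iUnion_singleton_eq_range, Set.range_id', measure_univ]
      · intro i j hij
        simpa using hij
    · intro i j hij
      refine Set.disjoint_left.2 fun ω hi hj => hij ?_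
      have : ((i : ℕ) : ℕ∞) = j := hi.symm.trans hj
      exact_mod_cast this
  have h2 := (mem_ae_iff_prob_eq_one (MeasurableSet.iUnion hm)).2 h1
  filter_upwards [h2] with ω hω
  obtain ⟨k, hk⟩ := Set.mem_iUnion.1 hω
  exact Set.finite_of_encard_eq_coe hk

/-- `ncard` sends infinite sets to `0`, which does not change the law because the point set is almost
surely finite in `A`. -/
lemma map_ncard (hη : IsPoissonPointProcess lam η Pr) {A : Set (EuclideanSpace ℝ (Fin d))}
    (hA : MeasurableSet A) (hv : volume A ≠ ∞) :
    Measurable (fun ω => (η ω ∩ A).ncard) ∧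
    Pr.map (fun ω => (η ω ∩ A).ncard) = poissonMeasure (lam * (volume A).toNNReal) := by
  have hmeas : Measurable (fun ω => (η ω ∩ A).ncard) := by
    have : Measurable (ENat.toNat) := measurable_of_countable _
    exact this.comp (hη.measurable_count A hA)
  refine ⟨hmeas, Measure.ext_of_singleton fun k => ?_⟩
  rw [Measure.map_apply hmeas (measurableSet_singleton k), ← hη.law_count A hA hv]
  refine measure_congr ?_
  filter_upwards [hη.ae_finite hA hv] with ω hω
  refine propext ?_
  change (η ω ∩ A).ncard = k ↔ (η ω ∩ A).encard = k
  rw [← hω.cast_ncard_eq]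
  exact_mod_cast Iff.rfl

/-- Exponential concentration of the number of points in a set. -/
lemma measureReal_ncard_le (hη : IsPoissonPointProcess lam η Pr)
    {A : Set (EuclideanSpace ℝ (Fin d))} (hA : MeasurableSet A) (hv : volume A ≠ ∞) :
    (∀ q : ℝ, 0 < q → q ≤ 1 → ∀ s : ℝ, lam * volume.real A ≤ q * s →
      Pr.real {ω | s ≤ (η ω ∩ A).ncard} ≤ Real.exp (-(q - 1 - Real.log q) * s)) ∧
    (∀ q : ℝ, 1 ≤ q → ∀ s : ℝ, q * s ≤ lam * volume.real A →
      Pr.real {ω | ((η ω ∩ A).ncard : ℝ) ≤ s} ≤ Real.exp (-(q - 1 - Real.log q) * s)) := by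
  obtain ⟨hm, hmap⟩ := hη.map_ncard hA hv
  have hint : ∀ θ, Integrable (fun ω => Real.exp (θ * ((η ω ∩ A).ncard : ℝ))) Pr := fun θ => by
    have h := integrable_exp_mul_poissonMeasure (lam * (volume A).toNNReal) θ
    rw [← hmap] at h
    exact h.comp_measurable hm
  have hmgf : ∀ θ, mgf (fun ω => ((η ω ∩ A).ncard : ℝ)) Pr θ ≤
      Real.exp (lam * volume.real A * (Real.exp θ - 1)) := fun θ => by
    have h := integral_exp_mul_poissonMeasure (lam * (volume A).toNNReal) θ
    rw [← hmap, integral_map hm.aemeasurable .of_discrete] at h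
    rw [mgf, h]
    rfl
  exact ⟨fun q hq hq1 s hs => measureReal_ge_le_of_mgf_le hint hmgf hq hq1 hs,
    fun q hq1 s hs => measureReal_le_le_of_mgf_le hint hmgf hq1 hs⟩

/-- The Chernoff bounds are summable along integer radii, so the Borel–Cantelli lemma applies; the
independence of the counts in disjoint sets plays no role. -/
lemma ae_tendsto_ncard_ball (hd : 0 < d) (hlam : 0 < lam)
    (hη : IsPoissonPointProcess lam η Pr) :
    ∀ᵐ ω ∂Pr, Tendsto (fun n : ℕ => ((η ω ∩ Metric.ball 0 n).ncard : ℝ) / (n : ℝ) ^ d) atTop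
      (𝓝 (lam * volume.real (Metric.ball (0 : EuclideanSpace ℝ (Fin d)) 1))) := by
  set κ : ℝ := lam * volume.real (Metric.ball (0 : EuclideanSpace ℝ (Fin d)) 1) with hκ
  have hκ0 : 0 < κ := mul_pos (by exact_mod_cast hlam)
    (ENNReal.toReal_pos (Metric.measure_ball_pos _ _ one_pos).ne' measure_ball_lt_top.ne)
  have hvol : ∀ n : ℕ, 0 < n → lam * volume.real (Metric.ball (0 : EuclideanSpace ℝ (Fin d)) n)
      = κ * (n : ℝ) ^ d := fun n hn => by
    have : (0 : ℝ) < n := by exact_mod_cast hn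
    rw [hκ, Measure.real, Measure.addHaar_ball_of_pos _ _ this, ENNReal.toReal_mul,
      ENNReal.toReal_ofReal (by positivity), finrank_euclideanSpace_fin]
    simp only [Measure.real]
    ring
  have hexp : ∀ c : ℝ, 0 < c → Summable (fun n : ℕ => Real.exp (-c * (n : ℝ) ^ d)) := fun c hc => by
    have h := Real.summable_exp_nat_mul_iff.2 (neg_lt_zero.2 hc)
    refine Summable.of_nonneg_of_le (fun n => (Real.exp_pos _).le) (fun n => ?_) h
    rw [Real.exp_le_exp]
    have : (n : ℝ) ≤ (n : ℝ) ^ d := by exact_mod_cast Nat.le_self_pow hd.ne' n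
    nlinarith
  -- The Borel–Cantelli lemma for events of exponentially small probability.
  have hBC : ∀ (B : ℕ → Set Ω) (c : ℝ), 0 < c →
      (∀ n, 0 < n → Pr.real (B n) ≤ Real.exp (-c * (n : ℝ) ^ d)) →
      ∀ᵐ ω ∂Pr, ∀ᶠ n in atTop, ω ∉ B n := fun B c hc hB => by
    refine ae_eventually_notMem ?_
    have h1 : ∀ n, Pr (B n) ≤ ENNReal.ofReal (if n = 0 then 1 else Real.exp (-c * (n : ℝ) ^ d)) := by
      intro n
      split_ifs with hn
      · simpa using prob_le_one
      · rw [← ofReal_measureReal]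
        exact ENNReal.ofReal_le_ofReal (hB n (Nat.pos_of_ne_zero hn))
    refine ne_top_of_le_ne_top ?_ (ENNReal.tsum_le_tsum h1)
    refine Summable.tsum_ofReal_ne_top ?_
    refine (hexp c hc).congr_cofinite ?_
    rw [Nat.cofinite_eq_atTop]
    filter_upwards [eventually_gt_atTop 0] with n hn
    simp [hn.ne']
  have hup : ∀ k : ℕ, ∀ᵐ ω ∂Pr, ∀ᶠ n : ℕ in atTop,
      ((η ω ∩ Metric.ball 0 n).ncard : ℝ) / (n : ℝ) ^ d < κ * (1 + 1 / ((k : ℝ) + 1)) := fun k => by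
    have hk : 0 < 1 / ((k : ℝ) + 1) := by positivity
    set e := 1 + 1 / ((k : ℝ) + 1) with he
    have he1 : 1 < e := by linarith
    have hq := sub_one_sub_log_pos (q := e⁻¹) (by positivity) (inv_lt_one_of_one_lt₀ he1).ne
    have h := hBC (fun n => {ω | κ * e * (n : ℝ) ^ d ≤ ((η ω ∩ Metric.ball 0 n).ncard : ℝ)})
      ((e⁻¹ - 1 - Real.log e⁻¹) * (κ * e)) (by positivity) fun n hn => by
        refine (((hη.measureReal_ncard_le Metric.isOpen_ball.measurableSet
          measure_ball_lt_top.ne).1 e⁻¹ (by positivity) (inv_le_one_of_one_le₀ he1.le)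
            (κ * e * (n : ℝ) ^ d) ?_)).trans (le_of_eq ?_)
        · rw [hvol n hn]
          apply le_of_eq
          field_simp
        · congr 1
          ring
    filter_upwards [h] with ω hω
    filter_upwards [hω, eventually_gt_atTop 0] with n hn hn0
    have : (0 : ℝ) < (n : ℝ) ^ d := by positivity
    rw [div_lt_iff₀ this]
    simpa using hn
  have hlo : ∀ k : ℕ, ∀ᵐ ω ∂Pr, ∀ᶠ n : ℕ in atTop,
      κ / (1 + 1 / ((k : ℝ) + 1)) < ((η ω ∩ Metric.ball 0 n).ncard : ℝ) / (n : ℝ) ^ d := fun k => by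
    have hk : 0 < 1 / ((k : ℝ) + 1) := by positivity
    set e := 1 + 1 / ((k : ℝ) + 1) with he
    have he1 : 1 < e := by linarith
    have hq := sub_one_sub_log_pos (q := e) (by positivity) he1.ne'
    have h := hBC (fun n => {ω | ((η ω ∩ Metric.ball 0 n).ncard : ℝ) ≤ κ / e * (n : ℝ) ^ d})
      ((e - 1 - Real.log e) * (κ / e)) (by positivity) fun n hn => by
        refine (((hη.measureReal_ncard_le Metric.isOpen_ball.measurableSet
          measure_ball_lt_top.ne).2 e he1.le (κ / e * (n : ℝ) ^ d) ?_)).trans (le_of_eq ?_)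
        · rw [hvol n hn]
          apply le_of_eq
          field_simp
        · congr 1
          ring
    filter_upwards [h] with ω hω
    filter_upwards [hω, eventually_gt_atTop 0] with n hn hn0
    have : (0 : ℝ) < (n : ℝ) ^ d := by positivity
    rw [lt_div_iff₀ this]
    simpa using hn
  have hlim : Tendsto (fun k : ℕ => 1 + 1 / ((k : ℝ) + 1)) atTop (𝓝 1) := by
    simpa using tendsto_one_div_add_atTop_nhds_zero_nat.const_add (1 : ℝ)
  have hlim1 : Tendsto (fun k : ℕ => κ * (1 + 1 / ((k : ℝ) + 1))) atTop (𝓝 κ) := by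
    simpa using hlim.const_mul κ
  have hlim2 : Tendsto (fun k : ℕ => κ / (1 + 1 / ((k : ℝ) + 1))) atTop (𝓝 κ) := by
    have h := (tendsto_const_nhds (x := κ)).div hlim one_ne_zero
    rwa [div_one] at h
  filter_upwards [ae_all_iff.2 hup, ae_all_iff.2 hlo] with ω h1 h2
  refine tendsto_order.2 ⟨fun a ha => ?_, fun a ha => ?_⟩
  · obtain ⟨k, hk⟩ := (hlim2.eventually (lt_mem_nhds ha)).exists
    filter_upwards [h2 k] with n hn using hk.trans hn
  · obtain ⟨k, hk⟩ := (hlim1.eventually (gt_mem_nhds ha)).exists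
    filter_upwards [h1 k] with n hn using hn.trans hk

end IsPoissonPointProcess

/-! ### Counting the points around a vertex -/

/-- The asymptotic density along balls of integer radius around the origin passes to punctured balls of
real radius around a vertex, which are nested between balls of radii `⌊r - ‖x‖⌋` and `⌈r + ‖x‖⌉`. -/
lemma tendsto_ncard_punctured_ball {d : ℕ} (hd : 0 < d) {V : Set (EuclideanSpace ℝ (Fin d))} {κ : ℝ}
    (hfin : ∀ n : ℕ, (V ∩ Metric.ball 0 n).Finite)
    (hlim : Tendsto (fun n : ℕ => ((V ∩ Metric.ball 0 n).ncard : ℝ) / (n : ℝ) ^ d) atTop (𝓝 κ))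
    (x : V) :
    (∀ r : ℝ, {y : {y : V // y ≠ x} | ‖(x - y.1 : EuclideanSpace ℝ (Fin d))‖ < r}.Finite) ∧
    Tendsto (fun r : ℝ =>
      ({y : {y : V // y ≠ x} | ‖(x - y.1 : EuclideanSpace ℝ (Fin d))‖ < r}.ncard : ℝ) / r ^ d)
      atTop (𝓝 κ) := by
  set S : ℝ → Set {y : V // y ≠ x} :=
    fun r => {y | ‖(x - y.1 : EuclideanSpace ℝ (Fin d))‖ < r} with hS
  set j : {y : V // y ≠ x} → EuclideanSpace ℝ (Fin d) := fun y => y.1.1 with hj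
  have hjinj : Function.Injective j := Subtype.val_injective.comp Subtype.val_injective
  set b : ℝ := ‖(x : EuclideanSpace ℝ (Fin d))‖ with hb
  have hsub1 : ∀ r, j '' S r ⊆ V ∩ Metric.ball 0 (⌈r + b⌉₊ : ℕ) := by
    rintro r _ ⟨y, hy, rfl⟩
    refine ⟨y.1.2, mem_ball_zero_iff.2 ?_⟩
    have h1 : ‖(y.1 : EuclideanSpace ℝ (Fin d))‖ ≤ ‖(x - y.1 : EuclideanSpace ℝ (Fin d))‖ + b := by
      rw [norm_sub_rev]
      exact norm_le_norm_sub_add _ _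
    have h2 : ‖(x - y.1 : EuclideanSpace ℝ (Fin d))‖ < r := hy
    exact (h1.trans_lt (by linarith)).trans_le (Nat.le_ceil _)
  have hfinS : ∀ r, (S r).Finite := fun r =>
    Set.Finite.of_finite_image ((hfin _).subset (hsub1 r)) hjinj.injOn
  have hsub2 : ∀ r, b ≤ r →
      V ∩ Metric.ball 0 (⌊r - b⌋₊ : ℕ) ⊆ insert (x : EuclideanSpace ℝ (Fin d)) (j '' S r) := by
    rintro r hr y ⟨hyV, hy⟩
    by_cases hxy : y = x
    · exact Or.inl hxy
    · refine Or.inr ⟨⟨⟨y, hyV⟩, fun h => hxy (congrArg Subtype.val h)⟩, ?_, rfl⟩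
      have h1 := mem_ball_zero_iff.1 hy
      have h2 : ((⌊r - b⌋₊ : ℕ) : ℝ) ≤ r - b := Nat.floor_le (by linarith)
      have h3 := norm_sub_le (x : EuclideanSpace ℝ (Fin d)) y
      change ‖(x - y : EuclideanSpace ℝ (Fin d))‖ < r
      linarith
  refine ⟨hfinS, ?_⟩
  have hle1 : ∀ r, ((S r).ncard : ℝ) ≤ (V ∩ Metric.ball 0 (⌈r + b⌉₊ : ℕ)).ncard := fun r => by
    rw [← Set.ncard_image_of_injective _ hjinj]
    exact_mod_cast Set.ncard_le_ncard (hsub1 r) (hfin _)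
  have hle2 : ∀ r, b ≤ r →
      ((V ∩ Metric.ball 0 (⌊r - b⌋₊ : ℕ)).ncard : ℝ) - 1 ≤ (S r).ncard := fun r hr => by
    have h := (Set.ncard_le_ncard (hsub2 r hr) (((hfinS r).image j).insert _)).trans
      (Set.ncard_insert_le _ _)
    rw [Set.ncard_image_of_injective _ hjinj] at h
    have h' : ((V ∩ Metric.ball 0 (⌊r - b⌋₊ : ℕ)).ncard : ℝ) ≤ (S r).ncard + 1 := by exact_mod_cast h
    linarith
  have hshift : ∀ a : ℝ, Tendsto (fun r : ℝ => (r + a) / r) atTop (𝓝 1) := fun a => by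
    have h : Tendsto (fun r : ℝ => 1 + a / r) atTop (𝓝 (1 + 0)) :=
      tendsto_const_nhds.add (tendsto_const_nhds.div_atTop tendsto_id)
    rw [add_zero] at h
    refine h.congr' ?_
    filter_upwards [eventually_gt_atTop 0] with r hr
    field_simp
  have hcomp : ∀ (a : ℝ) (u : ℝ → ℕ), Tendsto (fun r => (u r : ℝ) / r) atTop (𝓝 1) →
      Tendsto u atTop atTop →
      Tendsto (fun r : ℝ => ((V ∩ Metric.ball 0 (u (r + a) : ℕ)).ncard : ℝ) / r ^ d)
        atTop (𝓝 κ) := fun a u hu hu' => by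
    have ht : Tendsto (fun r : ℝ => r + a) atTop atTop := tendsto_atTop_add_const_right _ _ tendsto_id
    have h := ((hlim.comp (hu'.comp ht)).mul (((hu.comp ht).mul (hshift a)).pow d))
    simp only [mul_one, one_pow] at h
    refine h.congr' ?_
    filter_upwards [eventually_gt_atTop 0, ht.eventually_gt_atTop 0,
      (hu'.comp ht).eventually_gt_atTop 0] with r hr hr' hr2
    have : (0 : ℝ) < u (r + a) := by exact_mod_cast hr2
    simp only [Function.comp]
    rw [div_mul_div_cancel₀ hr'.ne', div_pow, div_mul_div_cancel₀ (by positivity)]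
  have hu1 := hcomp b (fun r => ⌈r⌉₊) tendsto_nat_ceil_div_atTop tendsto_nat_ceil_atTop
  have hu2 := hcomp (-b) (fun r => ⌊r⌋₊) tendsto_nat_floor_div_atTop tendsto_nat_floor_atTop
  have hu3 : Tendsto (fun r : ℝ => 1 / r ^ d) atTop (𝓝 0) :=
    tendsto_const_nhds.div_atTop (tendsto_pow_atTop hd.ne')
  have hu4 := hu2.sub hu3
  rw [sub_zero] at hu4
  refine tendsto_of_tendsto_of_tendsto_of_le_of_le' hu4 hu1 ?_ ?_
  · filter_upwards [eventually_ge_atTop b, eventually_gt_atTop 0] with r hr hr0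
    rw [← sub_div]
    exact div_le_div_of_nonneg_right (hle2 r hr) (by positivity)
  · filter_upwards [eventually_gt_atTop 0] with r hr0
    exact div_le_div_of_nonneg_right (hle1 r) (by positivity)

/-- A counting function of points at positive distances that is asymptotic to `κ r ^ d` is bounded
by a multiple of `r ^ d` at all radii, not only at large ones. -/
lemma exists_ncard_le_mul_pow {ι : Type*} {δ : ι → ℝ} (hδ : ∀ i, 0 < δ i) {d : ℕ} {κ : ℝ}
    (hfin : ∀ r, {i | δ i < r}.Finite)
    (hlim : Tendsto (fun r : ℝ => ({i | δ i < r}.ncard : ℝ) / r ^ d) atTop (𝓝 κ)) :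
    ∃ K : ℝ, 0 ≤ K ∧ ∀ r, 0 < r → ({i | δ i < r}.ncard : ℝ) ≤ K * r ^ d := by
  obtain ⟨R, hR⟩ := eventually_atTop.1 (hlim.eventually (gt_mem_nhds (lt_add_one κ)))
  set R' := max R 1 with hR'
  have hR0 : 0 < R' := lt_max_of_lt_right one_pos
  obtain ⟨ε, hε, hεδ⟩ : ∃ ε > 0, ∀ i, ε ≤ δ i := by
    by_cases hne : {i | δ i < R'}.Nonempty
    · obtain ⟨i, hi, hmin⟩ := (hfin R').exists_minimalFor δ _ hne
      refine ⟨δ i, hδ i, fun k => ?_⟩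
      by_contra! hk
      exact hk.not_ge (hmin (hk.trans hi) hk.le)
    · refine ⟨R', hR0, fun i => ?_⟩
      by_contra! h
      exact hne ⟨i, h⟩
  refine ⟨max (κ + 1) (({i | δ i < R'}.ncard : ℝ) / ε ^ d), le_max_of_le_right (by positivity),
    fun r hr => ?_⟩
  have hrd : 0 < r ^ d := pow_pos hr d
  rcases le_total R' r with h | h
  · have h1 := hR r ((le_max_left _ _).trans h)
    rw [div_lt_iff₀ hrd] at h1
    exact h1.le.trans (mul_le_mul_of_nonneg_right (le_max_left _ _) hrd.le)
  rcases le_total r ε with h' | h'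
  · have : {i | δ i < r} = ∅ := by
      ext i
      simpa using h'.trans (hεδ i)
    rw [this]
    simp only [Set.ncard_empty, Nat.cast_zero]
    exact mul_nonneg (le_max_of_le_right (by positivity)) hrd.le
  · refine le_trans ?_ (mul_le_mul_of_nonneg_right (le_max_right _ _) hrd.le)
    have h1 : ({i | δ i < r}.ncard : ℝ) ≤ {i | δ i < R'}.ncard := by
      exact_mod_cast Set.ncard_le_ncard (fun i (hi : δ i < r) => hi.trans_le h) (hfin R')
    have h2 : ε ^ d ≤ r ^ d := pow_le_pow_left₀ hε.le h' d
    rw [div_mul_eq_mul_div, le_div_iff₀ (pow_pos hε d)]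
    exact mul_le_mul h1 h2 (by positivity) (by positivity)

/-! ### The expected number of neighbours of a vertex of given weight -/

/-- The distance below which a vertex of weight `a` is linked to a vertex of unit weight when the
uniform edge variable takes the value `u`: the links `u < 1 - exp (-(w * a / r ^ α))` are those with
`r < w ^ (1 / α) * linkRadius α (a, u)`. -/
noncomputable def linkRadius (α : ℝ) (z : ℝ × unitInterval) : ℝ :=
  (z.1 / (-Real.log (1 - z.2))) ^ α⁻¹

lemma measurable_linkRadius (α : ℝ) : Measurable (linkRadius α) := by
  unfold linkRadius
  fun_prop

lemma lt_link_iff {α w a u r : ℝ} (hα : 0 < α) (hw : 0 < w) (ha : 0 < a)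
    (hu : 0 < u) (hu1 : u < 1) (hr : 0 < r) :
    u < 1 - Real.exp (-(w * a / r ^ α)) ↔
      r < w ^ α⁻¹ * (a / (-Real.log (1 - u))) ^ α⁻¹ := by
  have hl : 0 < -Real.log (1 - u) := neg_pos.2 (Real.log_neg (by linarith) (by linarith))
  have hrα : 0 < r ^ α := Real.rpow_pos_of_pos hr α
  rw [← Real.mul_rpow hw.le (by positivity), Real.lt_rpow_inv_iff_of_pos hr.le (by positivity) hα,
    ← mul_div_assoc, lt_div_iff₀ hl, lt_sub_comm, ← Real.lt_log_iff_exp_lt (by linarith),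
    neg_lt, lt_div_iff₀ hrα, mul_comm (r ^ α)]

lemma linkRadius_pos {α : ℝ} {z : ℝ × unitInterval} (ha : 0 < z.1) (hu : 0 < (z.2 : ℝ))
    (hu1 : (z.2 : ℝ) < 1) : 0 < linkRadius α z := by
  have hl : 0 < -Real.log (1 - z.2) := neg_pos.2 (Real.log_neg (by linarith) (by linarith))
  unfold linkRadius
  positivity

lemma ae_unitInterval : ∀ᵐ u : unitInterval, 0 < (u : ℝ) ∧ (u : ℝ) < 1 := by
  have h : ∀ᵐ t : ℝ ∂(volume.restrict (Set.Icc 0 1)), 0 < t ∧ t < 1 := by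
    rw [← restrict_Ioo_eq_restrict_Icc]
    exact ae_restrict_mem measurableSet_Ioo
  exact (ae_restrict_iff_subtype measurableSet_Icc (p := fun t : ℝ => 0 < t ∧ t < 1)).1 h

lemma ae_weight_edge {μ : Measure ℝ} [IsProbabilityMeasure μ] (hμpos : μ (Set.Iic 0) = 0) :
    ∀ᵐ z ∂(μ.prod (volume : Measure unitInterval)),
      0 < z.1 ∧ 0 < (z.2 : ℝ) ∧ (z.2 : ℝ) < 1 := by
  have h1 : ∀ᵐ a ∂μ, 0 < a := by
    rw [ae_iff]
    simpa [Set.Iic] using hμpos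
  filter_upwards [Measure.quasiMeasurePreserving_fst.ae h1,
    Measure.quasiMeasurePreserving_snd.ae ae_unitInterval] with z hz hz2 using ⟨hz, hz2⟩

lemma lintegral_neg_log_rpow_lt_top {β : ℝ} (hβ : 0 < β) (hβ1 : β < 1) :
    ∫⁻ u : unitInterval, ENNReal.ofReal ((-Real.log (1 - u)) ^ (-β)) < ∞ := by
  have h1 : ∀ᵐ u : unitInterval, ENNReal.ofReal ((-Real.log (1 - u)) ^ (-β)) ≤
      ENNReal.ofReal ((u : ℝ) ^ (-β)) := by
    filter_upwards [ae_unitInterval] with u hu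
    refine ENNReal.ofReal_le_ofReal (Real.rpow_le_rpow_of_nonpos hu.1 ?_ (by linarith))
    linarith [Real.log_le_sub_one_of_pos (x := 1 - u) (by linarith [hu.2])]
  refine (lintegral_mono_ae h1).trans_lt ?_
  have h2 : IntegrableOn (fun u : ℝ => u ^ (-β)) (Set.Icc 0 1) := by
    rw [integrableOn_Icc_iff_integrableOn_Ioc, ← intervalIntegrable_iff_integrableOn_Ioc_of_le
      zero_le_one]
    exact intervalIntegral.intervalIntegrable_rpow' (by linarith)
  have h3 := lintegral_subtype_comap (μ := volume) (s := Set.Icc (0 : ℝ) 1) measurableSet_Icc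
    (fun u : ℝ => ENNReal.ofReal (u ^ (-β)))
  exact h3.trans_lt h2.lintegral_lt_top

lemma lintegral_linkRadius_pow {d : ℕ} (hd : 0 < d) {α : ℝ} (hα : (d : ℝ) < α)
    {μ : Measure ℝ} [IsProbabilityMeasure μ] (hμpos : μ (Set.Iic 0) = 0)
    (hmom : ∫⁻ a, ENNReal.ofReal (a ^ (d / α)) ∂μ ≠ ∞) :
    ∫⁻ z, ENNReal.ofReal (linkRadius α z ^ d) ∂(μ.prod volume) ≠ ∞ ∧
    ∫⁻ z, ENNReal.ofReal (linkRadius α z ^ d) ∂(μ.prod volume) ≠ 0 := by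
  have hd' : (0 : ℝ) < d := by exact_mod_cast hd
  have hα0 : 0 < α := hd'.trans hα
  constructor
  · have h1 : ∀ᵐ z ∂(μ.prod (volume : Measure unitInterval)),
        ENNReal.ofReal (linkRadius α z ^ d) =
        ENNReal.ofReal (z.1 ^ (d / α)) * ENNReal.ofReal ((-Real.log (1 - z.2)) ^ (-(d / α))) := by
      filter_upwards [ae_weight_edge hμpos] with z hz
      have hl : 0 < -Real.log (1 - z.2) :=
        neg_pos.2 (Real.log_neg (by linarith [hz.2.2]) (by linarith [hz.2.1]))
      rw [← ENNReal.ofReal_mul (Real.rpow_nonneg hz.1.le _), linkRadius,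
        ← Real.rpow_mul_natCast (div_pos hz.1 hl).le, Real.div_rpow hz.1.le hl.le,
        Real.rpow_neg hl.le, div_eq_mul_inv, inv_mul_eq_div]
    rw [lintegral_congr_ae h1, lintegral_prod_mul (f := fun a : ℝ => ENNReal.ofReal (a ^ (d / α)))
      (g := fun u : unitInterval => ENNReal.ofReal ((-Real.log (1 - u)) ^ (-(d / α))))
      (by fun_prop) (by fun_prop)]
    exact ENNReal.mul_ne_top hmom (lintegral_neg_log_rpow_lt_top (by positivity)
      ((div_lt_one hα0).2 hα)).ne
  · intro h
    rw [lintegral_eq_zero_iff (by have := measurable_linkRadius α; fun_prop)] at h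
    have h2 : ∀ᵐ z ∂(μ.prod (volume : Measure unitInterval)), False := by
      filter_upwards [ae_weight_edge hμpos, h] with z hz hz2
      have := linkRadius_pos (α := α) hz.1 hz.2.1 hz.2.2
      have h3 : linkRadius α z ^ d ≤ 0 := by simpa using hz2
      exact h3.not_gt (pow_pos this d)
    simp at h2
    exact absurd h2 (IsProbabilityMeasure.ne_zero _)

/-- The expected number of neighbours of a vertex of weight `w` grows like `w ^ (d / α)`. It is the
integral over `(a, u)` of the number of points within distance `w ^ (1 / α) * linkRadius α (a, u)`,
so that dominated convergence applies. -/
lemma exists_tendsto_tsum_link {d : ℕ} (hd : 0 < d) {α : ℝ} (hα : (d : ℝ) < α)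
    {μ : Measure ℝ} [IsProbabilityMeasure μ] (hμpos : μ (Set.Iic 0) = 0)
    (hmom : ∫⁻ a, ENNReal.ofReal (a ^ (d / α)) ∂μ ≠ ∞)
    {ι : Type*} [Countable ι] {δ : ι → ℝ} (hδ : ∀ i, 0 < δ i) {κ : ℝ} (hκ : 0 < κ)
    (hfin : ∀ r, {i | δ i < r}.Finite)
    (hlim : Tendsto (fun r : ℝ => ({i | δ i < r}.ncard : ℝ) / r ^ d) atTop (𝓝 κ)) :
    ∃ C : ℝ, 0 < C ∧ Tendsto (fun w : ℝ => (∑' i, (μ.prod (volume : Measure unitInterval))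
        {z | (z.2 : ℝ) < 1 - Real.exp (-(w * z.1 / δ i ^ α))}) / ENNReal.ofReal (w ^ (d / α)))
      atTop (𝓝 (ENNReal.ofReal C)) := by
  have hd' : (0 : ℝ) < d := by exact_mod_cast hd
  have hα0 : 0 < α := hd'.trans hα
  obtain ⟨hI1, hI2⟩ := lintegral_linkRadius_pow hd hα hμpos hmom
  set I := ∫⁻ z, ENNReal.ofReal (linkRadius α z ^ d) ∂(μ.prod volume) with hI
  refine ⟨κ * I.toReal, mul_pos hκ (ENNReal.toReal_pos hI2 hI1), ?_⟩
  rw [ENNReal.ofReal_mul hκ.le, ENNReal.ofReal_toReal hI1, hI]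
  obtain ⟨K, hK0, hK⟩ := exists_ncard_le_mul_pow hδ hfin hlim
  set N : ℝ → ℝ≥0∞ := fun r => ENNReal.ofReal ({i | δ i < r}.ncard : ℝ) with hN
  have hNmono : Monotone N := fun r s hrs => by
    refine ENNReal.ofReal_le_ofReal ?_
    exact_mod_cast Set.ncard_le_ncard (fun i (hi : δ i < r) => hi.trans_le hrs) (hfin s)
  have hρ := measurable_linkRadius α
  have hsum : ∀ w : ℝ, 0 < w → ∑' i, (μ.prod (volume : Measure unitInterval))
        {z | (z.2 : ℝ) < 1 - Real.exp (-(w * z.1 / δ i ^ α))} =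
      ∫⁻ z, N (w ^ α⁻¹ * linkRadius α z) ∂(μ.prod volume) := fun w hw => by
    have hmeas : ∀ i, MeasurableSet {z : ℝ × unitInterval |
        (z.2 : ℝ) < 1 - Real.exp (-(w * z.1 / δ i ^ α))} := fun i =>
      measurableSet_lt (by fun_prop) (by fun_prop)
    simp_rw [← lintegral_indicator_one (hmeas _)]
    rw [← lintegral_tsum fun i => (measurable_one.indicator (hmeas i)).aemeasurable]
    refine lintegral_congr_ae ?_
    filter_upwards [ae_weight_edge hμpos] with z hz
    have h1 : {i | δ i < w ^ α⁻¹ * linkRadius α z} =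
        {i | (z.2 : ℝ) < 1 - Real.exp (-(w * z.1 / δ i ^ α))} := by
      ext i
      exact (lt_link_iff hα0 hw hz.1 hz.2.1 hz.2.2 (hδ i)).symm
    simp only [hN]
    rw [ENNReal.ofReal_natCast, ← ENat.toENNReal_coe, (hfin _).cast_ncard_eq, h1,
      ← ENNReal.tsum_set_one,
      tsum_subtype {i | (z.2 : ℝ) < 1 - Real.exp (-(w * z.1 / δ i ^ α))} (fun _ => (1 : ℝ≥0∞))]
    rfl
  have hlimN : Tendsto (fun r : ℝ => N r / ENNReal.ofReal (r ^ d)) atTop (𝓝 (ENNReal.ofReal κ)) := by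
    refine (ENNReal.tendsto_ofReal hlim).congr' ?_
    filter_upwards [eventually_gt_atTop 0] with r hr
    rw [ENNReal.ofReal_div_of_pos (pow_pos hr d)]
  have hpow : ∀ w : ℝ, 0 < w → ∀ t : ℝ, (w ^ α⁻¹ * t) ^ d = w ^ (d / α) * t ^ d := fun w hw t => by
    rw [mul_pow, ← Real.rpow_mul_natCast hw.le, inv_mul_eq_div]
  have hmain : Tendsto (fun w : ℝ => ∫⁻ z, N (w ^ α⁻¹ * linkRadius α z) /
        ENNReal.ofReal (w ^ (d / α)) ∂(μ.prod (volume : Measure unitInterval))) atTop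
      (𝓝 (∫⁻ z, ENNReal.ofReal κ * ENNReal.ofReal (linkRadius α z ^ d) ∂(μ.prod volume))) := by
    refine tendsto_lintegral_filter_of_dominated_convergence
      (fun z => ENNReal.ofReal K * ENNReal.ofReal (linkRadius α z ^ d)) ?_ ?_ ?_ ?_
    · refine Eventually.of_forall fun w => ?_
      exact (hNmono.measurable.comp (by fun_prop)).div_const _
    · filter_upwards [eventually_gt_atTop 0] with w hw
      filter_upwards [ae_weight_edge hμpos] with z hz
      have hz' := linkRadius_pos (α := α) hz.1 hz.2.1 hz.2.2
      have hwp : 0 < w ^ ((d : ℝ) / α) := Real.rpow_pos_of_pos hw _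
      refine ENNReal.div_le_of_le_mul ?_
      rw [← ENNReal.ofReal_mul hK0, ← ENNReal.ofReal_mul (by positivity)]
      refine ENNReal.ofReal_le_ofReal ((hK _ (by positivity)).trans (le_of_eq ?_))
      rw [hpow w hw]
      ring
    · rw [lintegral_const_mul _ (by fun_prop)]
      exact ENNReal.mul_ne_top ENNReal.ofReal_ne_top hI1
    · filter_upwards [ae_weight_edge hμpos] with z hz
      have hz' := linkRadius_pos (α := α) hz.1 hz.2.1 hz.2.2
      have ht : Tendsto (fun w : ℝ => w ^ α⁻¹ * linkRadius α z) atTop atTop :=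
        (tendsto_rpow_atTop (inv_pos.2 hα0)).atTop_mul_const hz'
      have h := ENNReal.Tendsto.mul_const (b := ENNReal.ofReal (linkRadius α z ^ d))
        (hlimN.comp ht) (Or.inr ENNReal.ofReal_ne_top)
      refine h.congr' ?_
      filter_upwards [eventually_gt_atTop 0] with w hw
      have hwp : 0 < w ^ ((d : ℝ) / α) := Real.rpow_pos_of_pos hw _
      have h0 : ENNReal.ofReal (linkRadius α z ^ d) ≠ 0 := by
        simpa using pow_pos hz' d
      simp only [Function.comp]
      rw [hpow w hw, ENNReal.ofReal_mul hwp.le, ← ENNReal.mul_div_right_comm,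
        ENNReal.mul_div_mul_right _ _ h0 ENNReal.ofReal_ne_top]
  rw [lintegral_const_mul _ (by fun_prop)] at hmain
  refine hmain.congr' ?_
  filter_upwards [eventually_gt_atTop 0] with w hw
  rw [hsum w hw]
  simp_rw [div_eq_mul_inv]
  rw [lintegral_mul_const]
  exact hNmono.measurable.comp (by fun_prop)

/-! ### Concentration of the degree given the weight of the vertex -/

/-- The number of independent events that occur is sub-Poissonian. -/
lemma mgf_sum_indicator_pi_le {ι β : Type*} [Fintype ι] [MeasurableSpace β] (ν : Measure β)
    [IsProbabilityMeasure ν] {B : ι → Set β} (hB : ∀ i, MeasurableSet (B i)) (θ : ℝ) :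
    Integrable (fun z : ι → β => Real.exp (θ * ∑ i, (B i).indicator 1 (z i)))
      (Measure.pi fun _ => ν) ∧
    mgf (fun z : ι → β => ∑ i, (B i).indicator (1 : β → ℝ) (z i)) (Measure.pi fun _ => ν) θ ≤
      Real.exp ((∑ i, ν.real (B i)) * (Real.exp θ - 1)) := by
  have hfac : ∀ i b, Real.exp (θ * (B i).indicator (1 : β → ℝ) b) =
      1 + (B i).indicator (fun _ => Real.exp θ - 1) b := fun i b => by
    by_cases hb : b ∈ B i <;> simp [hb]
  have hI : ∀ i, Integrable (fun b => Real.exp (θ * (B i).indicator (1 : β → ℝ) b)) ν := fun i => by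
    simp_rw [hfac]
    exact (integrable_const _).add ((integrable_const _).indicator (hB i))
  simp_rw [mgf, Finset.mul_sum, Real.exp_sum]
  refine ⟨Integrable.fintype_prod hI, ?_⟩
  rw [integral_fintype_prod_eq_prod (𝕜 := ℝ) (μ := fun _ => ν)
    (f := fun i b => Real.exp (θ * (B i).indicator (1 : β → ℝ) b)), Finset.sum_mul, Real.exp_sum]
  refine Finset.prod_le_prod (fun i _ => integral_nonneg fun b => (Real.exp_pos _).le) fun i _ => ?_
  simp_rw [hfac]
  rw [integral_add (integrable_const _) ((integrable_const _).indicator (hB i)),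
    integral_indicator_const _ (hB i)]
  simp only [integral_const, probReal_univ, smul_eq_mul, mul_one]
  linarith [Real.add_one_le_exp (ν.real (B i) * (Real.exp θ - 1))]

namespace ScaleFreePercolation

variable {d : ℕ} {V : Set (EuclideanSpace ℝ (Fin d))}

instance (μ : Measure ℝ) [IsProbabilityMeasure μ] : IsProbabilityMeasure (quenchedLaw μ V) := by
  unfold quenchedLaw
  infer_instance

/-- The vertices that are linked to `x` when the weight of `x` is replaced by `w`. -/
def linkNbrs (α w : ℝ) (x : V) (g : Sample V) : Set {y : V // y ≠ x} :=
  {y | (g.2 s(x, y.1) : ℝ) <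
    linkProb α (x : EuclideanSpace ℝ (Fin d)) (y.1 : EuclideanSpace ℝ (Fin d)) w (g.1 y.1)}

/-- The values of the weight and of the edge variable for which `y` is linked to `x`, when the
weight of `x` is `w`. -/
def linkEvent (α w : ℝ) (x : V) (y : {y : V // y ≠ x}) : Set (ℝ × unitInterval) :=
  {z | (z.2 : ℝ) <
    1 - Real.exp (-(w * z.1 / ‖(x - y.1 : EuclideanSpace ℝ (Fin d))‖ ^ α))}

lemma measurableSet_linkEvent (α w : ℝ) (x : V) (y : {y : V // y ≠ x}) :
    MeasurableSet (linkEvent α w x y) :=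
  measurableSet_lt (by fun_prop) (by fun_prop)

lemma degree_eq (α : ℝ) (x : V) (g : Sample V) :
    degree α x g = (linkNbrs α (g.1 x) x g).encard := by
  have h : (graph α g).neighborSet x = Subtype.val '' linkNbrs α (g.1 x) x g := by
    ext y
    constructor
    · rintro ⟨h1, h2⟩
      exact ⟨⟨y, h1.symm⟩, h2, rfl⟩
    · rintro ⟨y, h, rfl⟩
      exact ⟨y.2.symm, h⟩
  rw [degree, h, Subtype.val_injective.encard_image]

/-- For a positive weight the neighbourhood is increasing in the weight of the vertex. A link forces
the weight of the other vertex to be positive, so no assumption on the other weights is needed. -/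
lemma linkNbrs_mono {α w w' : ℝ} (hw : 0 < w) (hw' : w ≤ w') (x : V) (g : Sample V) :
    linkNbrs α w x g ⊆ linkNbrs α w' x g := by
  intro y hy
  have hy : (g.2 s(x, y.1) : ℝ) < linkProb α (x : EuclideanSpace ℝ (Fin d)) y.1 w (g.1 y.1) := hy
  refine hy.trans_le ?_
  have h0 : 0 ≤ (g.2 s(x, y.1) : ℝ) := unitInterval.nonneg _
  have hr : 0 < ‖(x - y.1 : EuclideanSpace ℝ (Fin d))‖ := norm_pos_iff.2 <| sub_ne_zero.2 fun h =>
    y.2 (Subtype.ext h.symm)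
  have hrα := Real.rpow_pos_of_pos hr α
  have h1 : 0 < w * g.1 y.1 / ‖(x - y.1 : EuclideanSpace ℝ (Fin d))‖ ^ α := by
    have h2 := h0.trans_lt hy
    unfold linkProb at h2
    have h3 := Real.exp_lt_one_iff.1 (sub_pos.1 h2)
    linarith
  have h2 : 0 < g.1 y.1 := by
    rw [div_pos_iff_of_pos_right hrα] at h1
    exact (pos_iff_pos_of_mul_pos h1).1 hw
  unfold linkProb
  gcongr

/-- The weights of finitely many vertices and the variables of their edges to `x` are
independent. -/
lemma measurePreserving_edges (μ : Measure ℝ) [IsProbabilityMeasure μ] (x : V)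
    (S : Finset {y : V // y ≠ x}) :
    MeasurePreserving (fun (g : Sample V) (y : S) => (g.1 y.1.1, g.2 s(x, y.1.1)))
      (quenchedLaw μ V) (Measure.pi fun _ => μ.prod volume) := by
  have h1 : MeasurePreserving (fun (a : V → ℝ) (y : S) => a y.1.1)
      (Measure.infinitePi fun _ : V => μ) (Measure.pi fun _ => μ) := by
    refine ⟨by fun_prop, ?_⟩
    rw [← Measure.infinitePi_eq_pi]
    exact Measure.map_infinitePi_infinitePi_of_inj (P := fun _ : V => μ)
      (Subtype.val_injective.comp Subtype.val_injective)
  have h2 : MeasurePreserving (fun (u : Sym2 V → unitInterval) (y : S) => u s(x, y.1.1))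
      (Measure.infinitePi fun _ : Sym2 V => (volume : Measure unitInterval))
      (Measure.pi fun _ => volume) := by
    refine ⟨by fun_prop, ?_⟩
    rw [← Measure.infinitePi_eq_pi]
    refine Measure.map_infinitePi_infinitePi_of_inj
      (P := fun _ : Sym2 V => (volume : Measure unitInterval))
      (f := fun y : S => s(x, y.1.1)) fun y y' h => ?_
    exact Subtype.ext (Subtype.ext (Sym2.congr_right.1 h))
  exact ((measurePreserving_arrowProdEquivProdArrow ℝ unitInterval S (fun _ => μ)
    (fun _ => volume)).symm).comp (h1.prod h2)

lemma card_eq_sum_indicator (α w : ℝ) (x : V) (g : Sample V) (S : Finset {y : V // y ≠ x}) :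
    (((S : Set _) ∩ linkNbrs α w x g).ncard : ℝ) =
      ∑ y : S, (linkEvent α w x y.1).indicator (1 : ℝ × unitInterval → ℝ) (g.1 y.1.1, g.2 s(x, y.1.1)) := by
  classical
  have h1 : (S : Set _) ∩ linkNbrs α w x g =
      ((S.filter (· ∈ linkNbrs α w x g) : Finset _) : Set _) := by
    ext y
    simp
  rw [h1, Set.ncard_coe_finset, Finset.card_filter, ← Finset.sum_coe_sort S]
  push_cast
  refine Finset.sum_congr rfl fun y _ => ?_
  simp only [Set.indicator_apply, Pi.one_apply]
  rfl

/-- Chernoff bounds for the number of links from `x` to a finite set of vertices. -/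
lemma quenchedLaw_finset_le (μ : Measure ℝ) [IsProbabilityMeasure μ] (α w : ℝ) (x : V)
    (S : Finset {y : V // y ≠ x}) :
    (∀ q : ℝ, 0 < q → q ≤ 1 → ∀ s : ℝ,
      ∑ y ∈ S, (μ.prod volume).real (linkEvent α w x y) ≤ q * s →
      (quenchedLaw μ V).real {g | s ≤ ((S : Set _) ∩ linkNbrs α w x g).ncard} ≤
        Real.exp (-(q - 1 - Real.log q) * s)) ∧
    (∀ q : ℝ, 1 ≤ q → ∀ s : ℝ,
      q * s ≤ ∑ y ∈ S, (μ.prod volume).real (linkEvent α w x y) →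
      (quenchedLaw μ V).real {g | (((S : Set _) ∩ linkNbrs α w x g).ncard : ℝ) ≤ s} ≤
        Real.exp (-(q - 1 - Real.log q) * s)) := by
  have hmp := measurePreserving_edges μ x S
  have hB : ∀ y : S, MeasurableSet (linkEvent α w x y.1) := fun y =>
    measurableSet_linkEvent α w x y.1
  have hmeas : Measurable (fun z : S → ℝ × unitInterval =>
      ∑ y : S, (linkEvent α w x y.1).indicator (1 : ℝ × unitInterval → ℝ) (z y)) :=
    Finset.measurable_sum _ fun y _ =>
      ((measurable_one.indicator (hB y)).comp (measurable_pi_apply y))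
  rw [← Finset.sum_coe_sort S]
  have h := mgf_sum_indicator_pi_le (μ.prod (volume : Measure unitInterval)) hB
  simp_rw [card_eq_sum_indicator]
  constructor
  · intro q hq hq1 s hs
    refine le_trans (le_of_eq ?_)
      (measureReal_ge_le_of_mgf_le (fun θ => (h θ).1) (fun θ => (h θ).2) hq hq1 hs)
    exact congrArg ENNReal.toReal (hmp.measure_preimage
      (measurableSet_le measurable_const hmeas).nullMeasurableSet)
  · intro q hq1 s hs
    refine le_trans (le_of_eq ?_)
      (measureReal_le_le_of_mgf_le (fun θ => (h θ).1) (fun θ => (h θ).2) hq1 hs)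
    exact congrArg ENNReal.toReal (hmp.measure_preimage
      (measurableSet_le hmeas measurable_const).nullMeasurableSet)

lemma exists_finset_of_ofReal_lt_encard {ι : Type*} {T : Set ι} {s : ℝ}
    (h : ENNReal.ofReal s < (T.encard : ℝ≥0∞)) :
    ∃ S : Finset ι, s ≤ ((S : Set ι) ∩ T).ncard := by
  rcases T.finite_or_infinite with hT | hT
  · refine ⟨hT.toFinset, ?_⟩
    rw [hT.coe_toFinset, Set.inter_self]
    rw [← hT.cast_ncard_eq, ENat.toENNReal_coe, ← ENNReal.ofReal_natCast] at h
    exact ((ENNReal.ofReal_lt_ofReal_iff').1 h).1.le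
  · obtain ⟨n, hn⟩ := exists_nat_ge s
    obtain ⟨S, hS, hc⟩ := hT.exists_subset_card_eq n
    refine ⟨S, ?_⟩
    rwa [Set.inter_eq_left.2 hS, Set.ncard_coe_finset, hc]

/-- The bound for finite sets of vertices passes to the whole neighbourhood by monotone continuity. -/
lemma quenchedLaw_lt_encard_le (hV : V.Countable) (μ : Measure ℝ) [IsProbabilityMeasure μ]
    (α w : ℝ) (x : V) {q s : ℝ} (hq : 0 < q) (hq1 : q ≤ 1) (hs : 0 ≤ s)
    (hm : ∑' y, (μ.prod volume) (linkEvent α w x y) ≤ ENNReal.ofReal (q * s)) :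
    (quenchedLaw μ V).real
        {g | ENNReal.ofReal s < ((linkNbrs α w x g).encard : ℝ≥0∞)} ≤
      Real.exp (-(q - 1 - Real.log q) * s) := by
  classical
  have := hV.to_subtype
  rw [Measure.real]
  refine ENNReal.toReal_le_of_le_ofReal (Real.exp_pos _).le ?_
  have hsub : {g : Sample V | ENNReal.ofReal s < ((linkNbrs α w x g).encard : ℝ≥0∞)} ⊆
      ⋃ S : Finset {y : V // y ≠ x}, {g | s ≤ ((S : Set _) ∩ linkNbrs α w x g).ncard} :=
    fun g hg => Set.mem_iUnion.2 (exists_finset_of_ofReal_lt_encard hg)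
  refine (measure_mono hsub).trans ?_
  rw [Directed.measure_iUnion]
  · refine iSup_le fun S => ?_
    rw [← ofReal_measureReal]
    refine ENNReal.ofReal_le_ofReal ((quenchedLaw_finset_le μ α w x S).1 q hq hq1 s ?_)
    have h1 := (ENNReal.sum_le_tsum S).trans hm
    have h2 := ENNReal.toReal_mono ENNReal.ofReal_ne_top h1
    rwa [ENNReal.toReal_sum (fun _ _ => measure_ne_top _ _),
      ENNReal.toReal_ofReal (by positivity)] at h2
  · refine Monotone.directed_le fun S S' hS g (hg : s ≤ _) => hg.trans ?_
    exact_mod_cast Set.ncard_le_ncard (Set.inter_subset_inter_left _ (Finset.coe_subset.2 hS))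
      (S'.finite_toSet.inter_of_left _)

/-- No summability is needed here: finitely many vertices already carry more than `q * s` of the mean. -/
lemma quenchedLaw_encard_le_le (μ : Measure ℝ) [IsProbabilityMeasure μ]
    (α w : ℝ) (x : V) {q s : ℝ} (hq1 : 1 ≤ q) (hs : 0 ≤ s)
    (hm : ENNReal.ofReal (q * s) < ∑' y, (μ.prod volume) (linkEvent α w x y)) :
    (quenchedLaw μ V).real
        {g | ((linkNbrs α w x g).encard : ℝ≥0∞) ≤ ENNReal.ofReal s} ≤
      Real.exp (-(q - 1 - Real.log q) * s) := by
  rw [ENNReal.tsum_eq_iSup_sum] at hm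
  obtain ⟨S, hS⟩ := lt_iSup_iff.1 hm
  refine le_trans (measureReal_mono ?_ (measure_ne_top _ _))
    ((quenchedLaw_finset_le μ α w x S).2 q hq1 s ?_)
  · intro g hg
    rw [Set.mem_ofPred_eq] at hg ⊢
    have hfin : (linkNbrs α w x g).Finite := by
      by_contra h
      rw [Set.Infinite.encard_eq h] at hg
      simp at hg
    rw [← hfin.cast_ncard_eq, ENat.toENNReal_coe, ← ENNReal.ofReal_natCast,
      ENNReal.ofReal_le_ofReal_iff hs] at hg
    refine le_trans ?_ hg
    exact_mod_cast Set.ncard_le_ncard Set.inter_subset_right hfin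
  · have h2 := ENNReal.toReal_mono (by simp) hS.le
    rwa [ENNReal.toReal_sum (fun _ _ => measure_ne_top _ _),
      ENNReal.toReal_ofReal (by positivity)] at h2

lemma quenchedLaw_weight (μ : Measure ℝ) [IsProbabilityMeasure μ] (x : V) {A : Set ℝ}
    (hA : MeasurableSet A) : (quenchedLaw μ V).real {g | g.1 x ∈ A} = μ.real A := by
  have h : MeasurePreserving (fun g : Sample V => g.1 x) (quenchedLaw μ V) μ :=
    (measurePreserving_eval_infinitePi (fun _ : V => μ) x).comp measurePreserving_fst
  exact congrArg ENNReal.toReal (h.measure_preimage hA.nullMeasurableSet)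

/-- A degree above `s` requires either a weight above `w` or an atypically large number of links
of a vertex of weight `w`. -/
lemma quenchedLaw_degree_le (hV : V.Countable) (μ : Measure ℝ) [IsProbabilityMeasure μ]
    (hμpos : μ (Set.Iic 0) = 0) (α w : ℝ) (x : V) {q s : ℝ} (hq : 0 < q) (hq1 : q ≤ 1) (hs : 0 ≤ s)
    (hm : ∑' y, (μ.prod volume) (linkEvent α w x y) ≤ ENNReal.ofReal (q * s)) :
    (quenchedLaw μ V).real {g | ENNReal.ofReal s < (degree α x g : ℝ≥0∞)} ≤
      μ.real (Set.Ioi w) + Real.exp (-(q - 1 - Real.log q) * s) := by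
  have hsub : {g : Sample V | ENNReal.ofReal s < (degree α x g : ℝ≥0∞)} ⊆
      ({g | g.1 x ∈ Set.Iic 0} ∪ {g | g.1 x ∈ Set.Ioi w}) ∪
        {g | ENNReal.ofReal s < ((linkNbrs α w x g).encard : ℝ≥0∞)} := by
    intro g hg
    rw [Set.mem_ofPred_eq] at hg
    by_cases h1 : g.1 x ≤ 0
    · exact Or.inl (Or.inl h1)
    by_cases h2 : w < g.1 x
    · exact Or.inl (Or.inr h2)
    refine Or.inr (lt_of_lt_of_le hg ?_)
    rw [degree_eq]
    exact ENat.toENNReal_mono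
      (Set.encard_le_encard (linkNbrs_mono (not_le.1 h1) (not_lt.1 h2) x g))
  refine (measureReal_mono hsub (measure_ne_top _ _)).trans ?_
  refine (measureReal_union_le _ _).trans (add_le_add ((measureReal_union_le _ _).trans ?_)
    (quenchedLaw_lt_encard_le hV μ α w x hq hq1 hs hm))
  rw [quenchedLaw_weight μ x measurableSet_Iic, quenchedLaw_weight μ x measurableSet_Ioi]
  simp [Measure.real, hμpos]

/-- A weight above `w` produces a degree above `s`, unless the number of links of a vertex of
weight `w` is atypically small. -/
lemma le_quenchedLaw_degree (μ : Measure ℝ) [IsProbabilityMeasure μ] (α : ℝ) {w : ℝ} (hw : 0 < w)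
    (x : V) {q s : ℝ} (hq1 : 1 ≤ q) (hs : 0 ≤ s)
    (hm : ENNReal.ofReal (q * s) < ∑' y, (μ.prod volume) (linkEvent α w x y)) :
    μ.real (Set.Ioi w) - Real.exp (-(q - 1 - Real.log q) * s) ≤
      (quenchedLaw μ V).real {g | ENNReal.ofReal s < (degree α x g : ℝ≥0∞)} := by
  have hsub : {g : Sample V | g.1 x ∈ Set.Ioi w} ⊆
      {g | ENNReal.ofReal s < (degree α x g : ℝ≥0∞)} ∪
        {g | ((linkNbrs α w x g).encard : ℝ≥0∞) ≤ ENNReal.ofReal s} := by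
    intro g (hg : w < g.1 x)
    by_cases h : ((linkNbrs α w x g).encard : ℝ≥0∞) ≤ ENNReal.ofReal s
    · exact Or.inr h
    refine Or.inl ((not_le.1 h).trans_le ?_)
    rw [degree_eq]
    exact ENat.toENNReal_mono (Set.encard_le_encard (linkNbrs_mono hw hg.le x g))
  have h1 := (measureReal_mono (μ := quenchedLaw μ V) hsub (measure_ne_top _ _)).trans
    (measureReal_union_le _ _)
  rw [quenchedLaw_weight μ x measurableSet_Ioi] at h1
  linarith [quenchedLaw_encard_le_le μ α w x hq1 hs hm]

end ScaleFreePercolation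

/-! ### Regularly varying tails -/

/-- The tail `w ^ (-ρ) * L w` is regularly varying. -/
lemma IsSlowlyVarying.tendsto_tail_ratio {L F : ℝ → ℝ} (hL : IsSlowlyVarying L) {ρ : ℝ}
    (hF : ∀ w, 0 < w → F w = w ^ (-ρ) * L w) {c : ℝ} (hc : 0 < c) :
    Tendsto (fun t => F (c * t) / F t) atTop (𝓝 (c ^ (-ρ))) := by
  have h := (hL.tendsto c hc).const_mul (c ^ (-ρ))
  rw [mul_one] at h
  refine h.congr' ?_
  filter_upwards [eventually_gt_atTop 0] with t ht
  have h1 := hL.pos t ht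
  have h2 : 0 < t ^ (-ρ) := Real.rpow_pos_of_pos ht _
  rw [hF t ht, hF _ (mul_pos hc ht), Real.mul_rpow hc.le ht.le]
  field_simp

lemma IsSlowlyVarying.tail_pos {L F : ℝ → ℝ} (hL : IsSlowlyVarying L) {ρ : ℝ}
    (hF : ∀ w, 0 < w → F w = w ^ (-ρ) * L w) {w : ℝ} (hw : 0 < w) : 0 < F w := by
  rw [hF w hw]
  exact mul_pos (Real.rpow_pos_of_pos hw _) (hL.pos w hw)

/-- A monotone regularly varying tail is bounded below by a power, by iterating the ratio limit along
doublings. -/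
lemma IsSlowlyVarying.exists_le_tail {L F : ℝ → ℝ} (hL : IsSlowlyVarying L) {ρ : ℝ} (hρ : 0 < ρ)
    (hF : ∀ w, 0 < w → F w = w ^ (-ρ) * L w) (hanti : Antitone F) :
    ∃ K : ℝ, 0 < K ∧ ∀ᶠ t in atTop, K * t ^ (-(ρ + 1)) ≤ F t := by
  have h2 := hL.tendsto_tail_ratio hF two_pos
  have hlt : (2 : ℝ) ^ (-(ρ + 1)) < 2 ^ (-ρ) :=
    Real.rpow_lt_rpow_of_exponent_lt one_lt_two (by linarith)
  obtain ⟨t₁, ht₁⟩ := eventually_atTop.1 (h2.eventually (lt_mem_nhds hlt))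
  set t₀ := max t₁ 1 with ht₀
  have ht₀1 : 1 ≤ t₀ := le_max_right _ _
  have ht₀p : 0 < t₀ := by linarith
  have hind : ∀ n : ℕ, ((2 : ℝ) ^ n) ^ (-(ρ + 1)) * F t₀ ≤ F (2 ^ n * t₀) := by
    intro n
    induction n with
    | zero => simp
    | succ n ih =>
      have h1 : t₁ ≤ 2 ^ n * t₀ :=
        (le_max_left _ _).trans (le_mul_of_one_le_left ht₀p.le (one_le_pow₀ one_le_two))
      have h3 := ht₁ _ h1
      rw [lt_div_iff₀ (hL.tail_pos hF (by positivity))] at h3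
      rw [pow_succ', mul_assoc, Real.mul_rpow two_pos.le (by positivity), mul_assoc]
      exact (mul_le_mul_of_nonneg_left ih (by positivity)).trans h3.le
  have hF0 := hL.tail_pos hF ht₀p
  refine ⟨(2 / t₀) ^ (-(ρ + 1)) * F t₀, by positivity, ?_⟩
  filter_upwards [eventually_ge_atTop t₀] with t ht
  have htp : 0 < t := by linarith
  obtain ⟨n, hn1, hn2⟩ := exists_nat_pow_near (one_le_div ht₀p |>.2 ht) one_lt_two
  rw [le_div_iff₀ ht₀p] at hn1
  rw [div_lt_iff₀ ht₀p] at hn2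
  refine le_trans ?_ ((hind (n + 1)).trans (hanti hn2.le))
  have h4 : (2 : ℝ) ^ (n + 1) ≤ 2 / t₀ * t := by
    rw [pow_succ', div_mul_eq_mul_div, le_div_iff₀ ht₀p]
    linarith
  have h5 := Real.rpow_le_rpow_of_nonpos (by positivity) h4 (show -(ρ + 1) ≤ 0 by linarith)
  rw [Real.mul_rpow (by positivity) htp.le] at h5
  calc _ = (2 / t₀) ^ (-(ρ + 1)) * t ^ (-(ρ + 1)) * F t₀ := by ring
    _ ≤ _ := mul_le_mul_of_nonneg_right h5 hF0.le

/-- A law with regularly varying tail of index `ρ` has moments of all orders below `ρ`: over dyadic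
intervals the moment is dominated by a series of ratio tending to `2 ^ (β - ρ) < 1`. -/
lemma IsSlowlyVarying.lintegral_rpow_ne_top {L : ℝ → ℝ} (hL : IsSlowlyVarying L) {ρ β : ℝ}
    (hβ : 0 < β) (hβρ : β < ρ) {μ : Measure ℝ} [IsProbabilityMeasure μ]
    (hμpos : μ (Set.Iic 0) = 0) (htail : ∀ w, 0 < w → μ.real (Set.Ioi w) = w ^ (-ρ) * L w) :
    ∫⁻ a, ENNReal.ofReal (a ^ β) ∂μ ≠ ∞ := by
  set b : ℕ → ℝ := fun n => ((2 : ℝ) ^ (n + 1)) ^ β with hb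
  set A : ℕ → Set ℝ := fun n => Set.Ioi (2 ^ n) with hA
  have hb0 : ∀ n, 0 < b n := fun n => by positivity
  have hAp : ∀ n, 0 < μ.real (A n) := fun n =>
    hL.tail_pos (F := fun w => μ.real (Set.Ioi w)) htail (by positivity)
  have hsum : Summable (fun n => b n * μ.real (A n)) := by
    have hlt : (2 : ℝ) ^ (β - ρ) < 1 := Real.rpow_lt_one_of_one_lt_of_neg one_lt_two (by linarith)
    refine summable_of_ratio_test_tendsto_lt_one hlt
      (Eventually.of_forall fun n => (mul_pos (hb0 n) (hAp n)).ne') ?_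
    have h := ((hL.tendsto_tail_ratio (F := fun w => μ.real (Set.Ioi w)) htail two_pos).comp
      (tendsto_pow_atTop_atTop_of_one_lt one_lt_two)).const_mul ((2 : ℝ) ^ β)
    rw [← Real.rpow_add two_pos, ← sub_eq_add_neg] at h
    refine h.congr fun n => ?_
    rw [Real.norm_of_nonneg (mul_pos (hb0 _) (hAp _)).le,
      Real.norm_of_nonneg (mul_pos (hb0 _) (hAp _)).le]
    simp only [Function.comp, hb, hA]
    rw [pow_succ' _ (n + 1), Real.mul_rpow two_pos.le (by positivity), ← pow_succ']
    have h1 := hb0 n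
    have h2 := hAp n
    simp only [hb, hA] at h1 h2
    field_simp
  have hle : ∀ᵐ a ∂μ, ENNReal.ofReal (a ^ β) ≤
      1 + ∑' n, (A n).indicator (fun _ => ENNReal.ofReal (b n)) a := by
    have h1 : ∀ᵐ a ∂μ, 0 < a := by
      rw [ae_iff]
      simpa [Set.Iic] using hμpos
    filter_upwards [h1] with a ha
    rcases le_or_gt a 1 with h | h
    · refine le_add_right ?_
      exact ENNReal.ofReal_le_one.2 (Real.rpow_le_one ha.le h hβ.le)
    · obtain ⟨m, hm1, hm2⟩ := exists_mem_Ioc_zpow ha one_lt_two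
      have hm : 0 ≤ m := by
        by_contra! hm
        exact (h.trans_le hm2).not_ge (zpow_le_one_of_nonpos₀ one_le_two (by omega))
      lift m to ℕ using hm with n
      have hn1 : a ∈ A n := Set.mem_Ioi.2 (by exact_mod_cast hm1)
      have hn2 : a ≤ 2 ^ (n + 1) := by exact_mod_cast hm2
      refine le_add_left ((?_ : _ ≤ (A n).indicator (fun _ => ENNReal.ofReal (b n)) a).trans
        (ENNReal.le_tsum n))
      rw [Set.indicator_of_mem hn1]
      exact ENNReal.ofReal_le_ofReal (Real.rpow_le_rpow ha.le hn2 hβ.le)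
  refine ((lintegral_mono_ae hle).trans_lt ?_).ne
  rw [lintegral_add_left measurable_const, lintegral_tsum fun n =>
    (measurable_const.indicator measurableSet_Ioi).aemeasurable]
  rw [lintegral_one, measure_univ]
  refine ENNReal.add_lt_top.2 ⟨ENNReal.one_lt_top, lt_top_iff_ne_top.2 ?_⟩
  have h2 : ∀ n, ∫⁻ a, (A n).indicator (fun _ => ENNReal.ofReal (b n)) a ∂μ =
      ENNReal.ofReal (b n * μ.real (A n)) := fun n => by
    rw [lintegral_indicator_const measurableSet_Ioi, ENNReal.ofReal_mul (hb0 n).le,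
      ofReal_measureReal]
  rw [tsum_congr h2]
  exact hsum.tsum_ofReal_ne_top

/-- If `H` is squeezed, up to exponentially small errors, between the values of a regularly varying
tail at slightly perturbed arguments, then `H` is asymptotic to that tail. -/
lemma IsSlowlyVarying.tendsto_div_of_squeeze {L F H : ℝ → ℝ} (hL : IsSlowlyVarying L) {ρ β C : ℝ}
    (hρ : 0 < ρ) (hβ : 0 < β) (hC : 0 < C) (hF : ∀ w, 0 < w → F w = w ^ (-ρ) * L w)
    (hanti : Antitone F)
    (hup : ∀ q, 0 < q → q < 1 → ∃ c > 0, ∀ᶠ s in atTop,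
      H s ≤ F ((q * s / C) ^ β) + Real.exp (-c * s))
    (hlo : ∀ q, 1 < q → ∃ c > 0, ∀ᶠ s in atTop,
      F ((q * s / C) ^ β) - Real.exp (-c * s) ≤ H s) :
    Tendsto (fun s => H s / F ((s / C) ^ β)) atTop (𝓝 1) := by
  have hu : Tendsto (fun s : ℝ => (s / C) ^ β) atTop atTop :=
    (tendsto_rpow_atTop hβ).comp (tendsto_id.atTop_div_const hC)
  have hratio : ∀ q, 0 < q → Tendsto (fun s => F ((q * s / C) ^ β) / F ((s / C) ^ β)) atTop
      (𝓝 (q ^ (-(β * ρ)))) := fun q hq => by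
    have h := (hL.tendsto_tail_ratio hF (Real.rpow_pos_of_pos hq β)).comp hu
    rw [← Real.rpow_mul hq.le, mul_neg] at h
    refine h.congr' ?_
    filter_upwards [eventually_gt_atTop 0] with s hs
    simp only [Function.comp]
    rw [← Real.mul_rpow hq.le (by positivity), mul_div_assoc]
  have hexp : ∀ c, 0 < c → Tendsto (fun s => Real.exp (-c * s) / F ((s / C) ^ β)) atTop (𝓝 0) := by
    intro c hc
    obtain ⟨K, hK, hKF⟩ := hL.exists_le_tail hρ hF hanti
    have h := (tendsto_rpow_mul_exp_neg_mul_atTop_nhds_zero (β * (ρ + 1)) c hc).const_mul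
      ((C ^ (β * (ρ + 1)))⁻¹ / K)
    rw [mul_zero] at h
    refine squeeze_zero' ?_ ?_ h
    · filter_upwards [hu.eventually_gt_atTop 0] with s hs
      exact div_nonneg (Real.exp_pos _).le (hL.tail_pos hF hs).le
    · filter_upwards [hu.eventually hKF, eventually_gt_atTop 0] with s hs hs0
      have hsC : 0 < s / C := by positivity
      have h1 : ((s / C) ^ β) ^ (-(ρ + 1)) = (s ^ (β * (ρ + 1)) / C ^ (β * (ρ + 1)))⁻¹ := by
        rw [← Real.rpow_mul hsC.le, mul_neg, Real.rpow_neg hsC.le, Real.div_rpow hs0.le hC.le]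
      rw [h1] at hs
      refine (div_le_div_of_nonneg_left (Real.exp_pos _).le (by positivity) hs).trans (le_of_eq ?_)
      have := Real.rpow_pos_of_pos hs0 (β * (ρ + 1))
      have := Real.rpow_pos_of_pos hC (β * (ρ + 1))
      field_simp
  have hcont : ContinuousAt (fun q : ℝ => q ^ (-(β * ρ))) 1 :=
    Real.continuousAt_rpow_const _ _ (Or.inl one_ne_zero)
  have hc1 : Tendsto (fun q : ℝ => q ^ (-(β * ρ))) (𝓝 1) (𝓝 1) := by
    simpa [ContinuousAt] using hcont
  refine tendsto_order.2 ⟨fun a ha => ?_, fun a ha => ?_⟩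
  · obtain ⟨q, hq, hq1⟩ := (((hc1.mono_left nhdsWithin_le_nhds).eventually
      (lt_mem_nhds ha)).and (self_mem_nhdsWithin (s := Set.Ioi (1 : ℝ)) (a := 1))).exists
    have hq1 : 1 < q := hq1
    obtain ⟨c, hc, hH⟩ := hlo q hq1
    have h := (hratio q (by linarith)).sub (hexp c hc)
    rw [sub_zero] at h
    filter_upwards [h.eventually (lt_mem_nhds hq), hH, hu.eventually_gt_atTop 0] with s h1 h2 h3
    refine h1.trans_le ?_
    rw [← sub_div]
    exact div_le_div_of_nonneg_right h2 (hL.tail_pos hF h3).le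
  · obtain ⟨q, hq, hq0, hq1⟩ := (((hc1.mono_left nhdsWithin_le_nhds).eventually
      (gt_mem_nhds ha)).and (Ioo_mem_nhdsLT (show (0 : ℝ) < 1 from one_pos))).exists
    obtain ⟨c, hc, hH⟩ := hup q hq0 hq1
    have h := (hratio q hq0).add (hexp c hc)
    rw [add_zero] at h
    filter_upwards [h.eventually (gt_mem_nhds hq), hH, hu.eventually_gt_atTop 0] with s h1 h2 h3
    refine lt_of_le_of_lt ?_ h1
    rw [← add_div]
    exact div_le_div_of_nonneg_right h2 (hL.tail_pos hF h3).le

/-- A nonincreasing function asymptotic to a regularly varying tail is a power times a slowly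
varying function. -/
lemma exists_isSlowlyVarying_of_tendsto_div {L F H : ℝ → ℝ} (hL : IsSlowlyVarying L) {ρ β C : ℝ}
    (hβ : 0 < β) (hC : 0 < C) (hF : ∀ w, 0 < w → F w = w ^ (-ρ) * L w) (hH : Antitone H)
    (hlim : Tendsto (fun s => H s / F ((s / C) ^ β)) atTop (𝓝 1)) :
    ∃ ℓ : ℝ → ℝ, IsSlowlyVarying ℓ ∧ ∀ s, 0 < s → H s = s ^ (-(β * ρ)) * ℓ s := by
  have hu : Tendsto (fun s : ℝ => (s / C) ^ β) atTop atTop :=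
    (tendsto_rpow_atTop hβ).comp (tendsto_id.atTop_div_const hC)
  have hpos : ∀ s, 0 < H s := fun s => by
    obtain ⟨t, h1, h2, h3⟩ := ((hlim.eventually (lt_mem_nhds one_pos)).and
      ((hu.eventually_gt_atTop 0).and (eventually_ge_atTop s))).exists
    exact ((div_pos_iff_of_pos_right (hL.tail_pos hF h2)).1 h1).trans_le (hH h3)
  refine ⟨fun s => s ^ (β * ρ) * H s, ⟨fun t ht => ?_, ?_, fun c hc => ?_⟩, fun s hs => ?_⟩
  · exact mul_pos (Real.rpow_pos_of_pos ht _) (hpos t)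
  · have := hH.measurable
    fun_prop
  · have hct : Tendsto (fun t : ℝ => c * t) atTop atTop := tendsto_id.const_mul_atTop hc
    have h1 := (hL.tendsto_tail_ratio hF (Real.rpow_pos_of_pos hc β)).comp hu
    have h2 := (((hlim.comp hct).mul h1).div hlim one_ne_zero).const_mul (c ^ (β * ρ))
    rw [one_mul, div_one, ← Real.rpow_mul hc.le, mul_neg, ← Real.rpow_add hc, add_neg_cancel,
      Real.rpow_zero] at h2
    refine h2.congr' ?_
    filter_upwards [eventually_gt_atTop 0] with t ht
    have e : (c * t / C) ^ β = c ^ β * (t / C) ^ β := by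
      rw [mul_div_assoc, Real.mul_rpow hc.le (by positivity)]
    have f1 := hL.tail_pos hF (w := (t / C) ^ β) (by positivity)
    have f2 := hL.tail_pos hF (w := c ^ β * (t / C) ^ β) (by positivity)
    have f3 := hpos t
    have f4 := Real.rpow_pos_of_pos ht (β * ρ)
    simp only [Function.comp, Pi.div_apply]
    rw [e, Real.mul_rpow hc.le ht.le]
    field_simp
  · rw [← mul_assoc, ← Real.rpow_add hs, neg_add_cancel, Real.rpow_zero, one_mul]

/-! ### The degree of a vertex -/

/-- For a locally finite vertex set of positive asymptotic density, the tail of the degree of a vertex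
is asymptotic to the tail of its weight at `(s / C) ^ (α / d)`, the weight with mean degree about
`s`. -/
lemma ScaleFreePercolation.exists_tendsto_degree {d : ℕ} (hd : 0 < d) {α τ : ℝ} {μ : Measure ℝ}
    [IsProbabilityMeasure μ] (hμpos : μ (Set.Iic 0) = 0) {L : ℝ → ℝ} (hL : IsSlowlyVarying L)
    (htail : ∀ w : ℝ, 0 < w → μ.real (Set.Ioi w) = w ^ (-(τ - 1)) * L w)
    (hα : (d : ℝ) < α) (hγ : 1 < α * (τ - 1) / d) {V : Set (EuclideanSpace ℝ (Fin d))} {κ : ℝ}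
    (hκ : 0 < κ) (hfin : ∀ n : ℕ, (V ∩ Metric.ball 0 n).Finite)
    (hlim : Tendsto (fun n : ℕ => ((V ∩ Metric.ball 0 n).ncard : ℝ) / (n : ℝ) ^ d) atTop (𝓝 κ))
    (x : V) :
    ∃ C : ℝ, 0 < C ∧ Tendsto (fun s : ℝ =>
      (quenchedLaw μ V).real {g | ENNReal.ofReal s < (degree α x g : ℝ≥0∞)} /
        μ.real (Set.Ioi ((s / C) ^ (α / d)))) atTop (𝓝 1) := by
  have hd' : (0 : ℝ) < d := by exact_mod_cast hd
  have hα0 : 0 < α := hd'.trans hα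
  have hρ : d / α < τ - 1 := by
    rw [div_lt_iff₀ hα0]
    rw [one_lt_div hd'] at hγ
    linarith
  have hV : V.Countable := by
    have h : V ⊆ ⋃ n : ℕ, V ∩ Metric.ball 0 n := fun y hy => by
      obtain ⟨n, hn⟩ := exists_nat_gt ‖y‖
      exact Set.mem_iUnion.2 ⟨n, hy, mem_ball_zero_iff.2 hn⟩
    exact (Set.countable_iUnion fun n => (hfin n).countable).mono h
  have := hV.to_subtype
  have hδ : ∀ y : {y : V // y ≠ x}, 0 < ‖(x - y.1 : EuclideanSpace ℝ (Fin d))‖ := fun y =>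
    norm_pos_iff.2 (sub_ne_zero.2 fun h => y.2 (Subtype.ext h.symm))
  obtain ⟨hfin', hlim'⟩ := tendsto_ncard_punctured_ball hd hfin hlim x
  obtain ⟨C, hC, hM⟩ := exists_tendsto_tsum_link hd hα hμpos
    (hL.lintegral_rpow_ne_top (by positivity) hρ hμpos htail) hδ hκ hfin' hlim'
  -- Along the weights `(q s / C) ^ (α / d)` the mean degree is asymptotic to `q s`.
  have hmean : ∀ q, 0 < q → Tendsto (fun s : ℝ =>
      (∑' y, (μ.prod volume) (linkEvent α ((q * s / C) ^ (α / d)) x y)) /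
        ENNReal.ofReal (q * s / C)) atTop (𝓝 (ENNReal.ofReal C)) := fun q hq => by
    have h1 : Tendsto (fun s : ℝ => q * s / C) atTop atTop :=
      (tendsto_id.const_mul_atTop hq).atTop_div_const hC
    have h2 := hM.comp ((tendsto_rpow_atTop (div_pos hα0 hd')).comp h1)
    refine h2.congr' ?_
    filter_upwards [h1.eventually_gt_atTop 0] with s hs
    simp only [Function.comp]
    rw [← Real.rpow_mul hs.le, div_mul_div_cancel₀ hd'.ne', div_self hα0.ne', Real.rpow_one]
    rfl
  have hmul : ∀ q q' s : ℝ, 0 < q → 0 < q' → 0 < s →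
      ENNReal.ofReal (C * (q' / q)) * ENNReal.ofReal (q * s / C) = ENNReal.ofReal (q' * s) := by
    intro q q' s hq hq' hs
    rw [← ENNReal.ofReal_mul (by positivity)]
    congr 1
    field_simp
  refine ⟨C, hC, hL.tendsto_div_of_squeeze (F := fun w => μ.real (Set.Ioi w))
    ((div_pos hd' hα0).trans hρ) (div_pos hα0 hd') hC htail
    (fun a b hab => measureReal_mono (Set.Ioi_subset_Ioi hab)) (fun q hq hq1 => ?_)
    fun q hq1 => ?_⟩
  · obtain ⟨q', h1, h2⟩ := exists_between hq1
    have hq' : 0 < q' := hq.trans h1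
    refine ⟨q' - 1 - Real.log q', sub_one_sub_log_pos hq' h2.ne, ?_⟩
    have hC' : C < C * (q' / q) := lt_mul_of_one_lt_right hC ((one_lt_div hq).2 h1)
    filter_upwards [(hmean q hq).eventually (gt_mem_nhds
      ((ENNReal.ofReal_lt_ofReal_iff (hC.trans hC')).2 hC')), eventually_gt_atTop 0] with s hs hs0
    refine quenchedLaw_degree_le hV μ hμpos α _ x hq' h2.le hs0.le ?_
    have h0 : ENNReal.ofReal (q * s / C) ≠ 0 := by
      simpa using (show 0 < q * s / C by positivity)
    rw [← hmul q q' s hq hq' hs0]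
    exact (ENNReal.div_le_iff h0 ENNReal.ofReal_ne_top).1 hs.le
  · obtain ⟨q', h1, h2⟩ := exists_between hq1
    have hq : 0 < q := by linarith
    have hq' : 0 < q' := by linarith
    refine ⟨q' - 1 - Real.log q', sub_one_sub_log_pos hq' h1.ne', ?_⟩
    have hC' : C * (q' / q) < C := mul_lt_of_lt_one_right hC ((div_lt_one hq).2 h2)
    filter_upwards [(hmean q hq).eventually (lt_mem_nhds
      ((ENNReal.ofReal_lt_ofReal_iff hC).2 hC')), eventually_gt_atTop 0] with s hs hs0
    refine le_quenchedLaw_degree μ α (by positivity) x h1.le hs0.le ?_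
    rw [← hmul q q' s hq hq' hs0]
    exact ENNReal.mul_lt_of_lt_div hs

theorem theorem2p2 {d : ℕ} (hd : 0 < d)
    -- the intensity of the Poisson process and the parameters of the model
    (lam : ℝ≥0) (hlam : 0 < lam) (α τ : ℝ)
    -- the law of the weights: positive, with regularly varying tail of exponent `τ - 1`
    (μ : Measure ℝ) [IsProbabilityMeasure μ] (hμpos : μ (Set.Iic 0) = 0)
    (L : ℝ → ℝ) (hL : IsSlowlyVarying L)
    (htail : ∀ w : ℝ, 0 < w → μ.real (Set.Ioi w) = w ^ (-(τ - 1)) * L w)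
    -- the Poisson point process
    {Ω : Type*} [MeasurableSpace Ω] (Pr : Measure Ω) [IsProbabilityMeasure Pr]
    (η : Ω → Set (EuclideanSpace ℝ (Fin d))) (hη : IsPoissonPointProcess lam η Pr)
    (hα : (d : ℝ) < α) (hγ : 1 < α * (τ - 1) / d) :
    ∀ᵐ ω ∂Pr, ∀ x : η ω, ∃ ℓ : ℝ → ℝ, IsSlowlyVarying ℓ ∧
      ∀ s : ℝ, 0 < s →
        (ScaleFreePercolation.quenchedLaw μ (η ω)).real
            {g | ENNReal.ofReal s < (ScaleFreePercolation.degree α x g : ℝ≥0∞)} =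
          s ^ (-(α * (τ - 1) / d)) * ℓ s := by
  have hd' : (0 : ℝ) < d := by exact_mod_cast hd
  have hfin : ∀ᵐ ω ∂Pr, ∀ n : ℕ, (η ω ∩ Metric.ball 0 n).Finite :=
    ae_all_iff.2 fun n => hη.ae_finite Metric.isOpen_ball.measurableSet measure_ball_lt_top.ne
  filter_upwards [hfin, hη.ae_tendsto_ncard_ball hd hlam] with ω h1 h2 x
  have hκ : 0 < lam * volume.real (Metric.ball (0 : EuclideanSpace ℝ (Fin d)) 1) :=
    mul_pos (by exact_mod_cast hlam)
      (ENNReal.toReal_pos (Metric.measure_ball_pos _ _ one_pos).ne' measure_ball_lt_top.ne)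
  obtain ⟨C, hC, hlim⟩ :=
    ScaleFreePercolation.exists_tendsto_degree hd hμpos hL htail hα hγ hκ h1 h2 x
  have hanti : Antitone fun s : ℝ => (ScaleFreePercolation.quenchedLaw μ (η ω)).real
      {g | ENNReal.ofReal s < (ScaleFreePercolation.degree α x g : ℝ≥0∞)} := fun s t hst =>
    measureReal_mono (fun g hg => lt_of_le_of_lt (ENNReal.ofReal_le_ofReal hst) hg)
      (measure_ne_top _ _)
  obtain ⟨ℓ, hℓ, h⟩ := exists_isSlowlyVarying_of_tendsto_div hL
    (F := fun w => μ.real (Set.Ioi w)) (div_pos (hd'.trans hα) hd') hC htail hanti hlim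
  refine ⟨ℓ, hℓ, fun s hs => ?_⟩
  rw [mul_div_right_comm]
  exact h s hs
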